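/- **Theorem 5 (UNO sampling with noise).** For $\lambda>0$ let $\mathcal M_\lambda(u)=u-2\lambda\lfloor \frac{u}{2\lambda}+\frac12\rfloor$. For $\Omega>0$ let $\mathrm{PW}_\Omega$ be the space of real signals $f\in L^2(\mathbb R)$ (represented by their continuous versions) whose Fourier transform vanishes a.e. outside $[-\Omega,\Omega]$ (angular frequency). Fix $\lambda>0$, a positive $\beta_x\in 2\lambda\mathbb Z$ and $h\in\mathbb N$. Let $\Omega_{\max}>0$, $T>0$, $\zeta>1$; let $x\in \mathrm{PW}_{\Omega_{\max}}$ be the signal and $\phi\in\mathrm{PW}_{\Omega_{\max}}$ the impulse response of the pre-filter, let $z$ be a noise signal for which the convolution $z*\phi$ exists everywhere, and put $y=x+z$, $y_\phi=y*\phi$, $x_\phi=x*\phi$, $z_\phi=z*\phi$. Assume $\|x_\phi\|_\infty\le\beta_x$. If $\phi(t)=\frac{\sin(\Omega_{\max}t)}{\pi t}$ is the ideal low-pass filter, then $x_\phi=x$. Write $(f)_k=f(kT)$ for samples, $(\tilde x_\phi)_k=\mathcal M_\lambda((x_\phi)_k)$, $(\tilde y_\phi)_k=\mathcal M_\lambda((y_\phi)_k)$,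 and let $$(\tilde z_\phi)_k=(z_\phi)_k-2\lambda\Big\lfloor\frac{(z_\phi)_k}{2\lambda}\Big\rfloor-2(1-q_k)\lambda$$ be the folded noise, where $q_k\in\{0,1\}$ is the bit for which $(\tilde y_\phi)_k=(\tilde x_\phi)_k+(\tilde z_\phi)_k$. If $\bar{\tilde{\mathbf y}}_\phi$ is an estimate of the modulo samples $\tilde{\mathbf y}_\phi$, let $\mathbf e=\bar{\tilde{\mathbf y}}_\phi-\tilde{\mathbf y}_\phi$ be its error. Then the conditions $$T\le\frac1{2^h\Omega_{\max}e},\qquad \lambda\ge4\zeta\,\|\tilde{\mathbf z}_\phi+\mathbf e\|_\infty,\qquad h\ge\frac{\log(2\beta_x/\lambda)}{\log\big(\lambda/(4\|\tilde{\mathbf z}_\phi+\mathbf e\|_\infty)\big)}$$ ($e$ in the first one is Euler's number; the last quotient is read as $0$ if $\tilde{\mathbf z}_\phi+\mathbf e=0$) are sufficient for the reconstruction of the bandlimited samples up to one additive multiple of $2\lambda$, in the following two senses. 1. (All samples.) There is a reconstruction map $D:\mathbb R^{\mathbb Z}\to\mathbb R^{\mathbb Z}$, depending only on $\lambda,\beta_x,h$,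 such that for all data as above and every estimate $\bar{\tilde{\mathbf y}}_\phi\in\mathbb R^{\mathbb Z}$ that satisfies the conditions (with $\tilde{\mathbf z}_\phi+\mathbf e$ bounded on $\mathbb Z$) there is $a\in\mathbb Z$ with $$\big(D(\bar{\tilde{\mathbf y}}_\phi)\big)_k=(x_\phi)_k+(\tilde z_\phi)_k+e_k+2\lambda a\quad\text{for all }k .$$ 2. (Windows of samples, from UNO samples.) There are $n_0\in\mathbb N$ and maps $D_n:\mathbb R^n\to\mathbb R^n$, depending only on $\lambda,\beta_x,h$, such that for all data as above (the noise may be random), every $n\ge n_0$, every window of $n$ consecutive sampling instants, all random thresholds $\boldsymbol\tau^{(\ell)}\sim\mathcal N(\mathbf 0,\frac{\lambda^2}9\mathbf I_n)$, $\ell=1,\dots,m$, the following holds. Let $\mathbf r^{(\ell)}=\operatorname{sgn}(\mathcal M_\lambda(\mathbf y_\phi)-\boldsymbol\tau^{(\ell)})$ be the UNO samples on the window and let $\bar{\tilde{\mathbf y}}_\phi$ be the result, after any number of steps and from any starting vector, of the randomized Kaczmarz algorithm for the inequalities $r^{(\ell)}_kv_k\ge r^{(\ell)}_k\tau^{(\ell)}_k$;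 one step picks one of the $mn$ inequalities uniformly and independently of the other steps, writes it as $\mathbf c\mathbf v\le b$ and replaces $\mathbf v$ by $\mathbf v-\frac{(\mathbf c\mathbf v-b)^+}{\|\mathbf c\|_2^2}\mathbf c^\top$. For every outcome for which the conditions hold (with the maximum norm over the window) there is $a\in\mathbb Z$ with $$\big(D_n(\bar{\tilde{\mathbf y}}_\phi)\big)_k=(x_\phi)_k+(\tilde z_\phi)_k+e_k+2\lambda a\quad\text{for all }k\text{ in the window.}$$ If $\phi$ is the ideal low-pass filter, both conclusions hold with $x_k=x(kT)$ in place of $(x_\phi)_k$. -/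

import Mathlib

open MeasureTheory ProbabilityTheory Set
open scoped FourierTransform

namespace UNO

noncomputable section

/-- The Paley-Wiener space of real signals of finite energy with (angular) frequencies in
`[-W, W]`; each element is represented by its continuous version, so that point samples make
sense. Mathlib's Fourier transform uses the frequency variable `ξ = ω / (2π)`. -/
def PaleyWiener (W : ℝ) (f : ℝ → ℝ) : Prop :=
  Continuous f ∧
    ∃ hf : MemLp (fun t : ℝ => (f t : ℂ)) 2 volume,
      ∀ᵐ ξ : ℝ, W < |2 * Real.pi * ξ| → (𝓕 (hf.toLp (fun t : ℝ => (f t : ℂ)))) ξ = 0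

/-- The output of the filter with impulse response `φ` for the input `f`:
`t ↦ ∫ f(s) φ(t - s) ds`. -/
def filtered (φ f : ℝ → ℝ) : ℝ → ℝ :=
  convolution f φ (ContinuousLinearMap.mul ℝ ℝ) volume

/-- The output of the filter is given by convergent integrals. -/
def Filterable (φ f : ℝ → ℝ) : Prop :=
  ConvolutionExists f φ (ContinuousLinearMap.mul ℝ ℝ) volume

/-- Impulse response `t ↦ sin (W t) / (π t)` of the ideal low-pass filter with cut-off `W`. -/
def idealLowPass (W : ℝ) : ℝ → ℝ := fun t => W / Real.pi * Real.sinc (W * t)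

/-- The `k`-th uniform sample of `f` with sampling period `T`. -/
def sample (T : ℝ) (f : ℝ → ℝ) (k : ℤ) : ℝ := f (k * T)

/-- The centered modulo operator, which folds a real number into `[-lam, lam)`. -/
def fold (lam x : ℝ) : ℝ := x - 2 * lam * ⌊x / (2 * lam) + 1 / 2⌋

/-- The remainder of the division `a / b`. -/
def rem (a b : ℝ) : ℝ := a - b * ⌊a / b⌋

/-- The bit `q` telling whether the floor is additive in the folding of `x + z`. -/
def foldBit (lam x z : ℝ) : ℝ :=
  if ⌊x / (2 * lam) + 1 / 2 + z / (2 * lam)⌋ = ⌊x / (2 * lam) + 1 / 2⌋ + ⌊z / (2 * lam)⌋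
  then 1 else 0

/-- The folded noise `mod (z, 2 lam) - 2 (1 - q) lam`. -/
def foldedNoise (lam x z : ℝ) : ℝ :=
  rem z (2 * lam) - 2 * (1 - foldBit lam x z) * lam

/-- The folded noise is the additive noise seen after folding. -/
theorem fold_add (lam x z : ℝ) : fold lam (x + z) = fold lam x + foldedNoise lam x z := by
  have h1 := Int.le_floor_add (x / (2 * lam) + 1 / 2) (z / (2 * lam))
  have h2 := Int.le_floor_add_floor (x / (2 * lam) + 1 / 2) (z / (2 * lam))
  have h3 : (x + z) / (2 * lam) + 1 / 2 = x / (2 * lam) + 1 / 2 + z / (2 * lam) := by ring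
  unfold fold foldedNoise rem foldBit
  rw [h3]
  split_ifs with h
  · rw [h]; push_cast; ring
  · have h4 : ⌊x / (2 * lam) + 1 / 2 + z / (2 * lam)⌋
        = ⌊x / (2 * lam) + 1 / 2⌋ + ⌊z / (2 * lam)⌋ + 1 := by omega
    rw [h4]; push_cast; ring

/-- One-bit samples of the vector `v` with the threshold sequences `τ 0, …, τ (m - 1)`. -/
def oneBit {m n : ℕ} (v : Fin n → ℝ) (τ : Fin m → Fin n → ℝ) : Fin m → Fin n → ℝ :=
  fun l k => Real.sign (v k - τ l k)

/-- One Kaczmarz step for the single linear inequality `c ⬝ v ≤ b`. -/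
def kaczmarzStep {n : ℕ} (c : Fin n → ℝ) (b : ℝ) (v : Fin n → ℝ) : Fin n → ℝ :=
  v - (max (c ⬝ᵥ v - b) 0 / (c ⬝ᵥ c)) • c

/-- The Kaczmarz iterates for the one-bit polyhedron
`{v | r l k * v k ≥ r l k * τ l k for all l, k}`, started at `v₀`, where the inequality used in
step `i` is the one with index `j i`. -/
def rka {m n : ℕ} (r τ : Fin m → Fin n → ℝ) (v₀ : Fin n → ℝ) (j : ℕ → Fin m × Fin n) :
    ℕ → Fin n → ℝ
  | 0 => v₀
  | i + 1 =>
      kaczmarzStep (Pi.single (j i).2 (-(r (j i).1 (j i).2)))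
        (-(r (j i).1 (j i).2 * τ (j i).1 (j i).2)) (rka r τ v₀ j i)

/-- The condition linking the oversampling exponent `h` and the folding threshold `lam` to the
maximal perturbation `E` of the modulo samples and the amplitude bound `β`. -/
def Admissible (lam β ζ : ℝ) (h : ℕ) (E : ℝ) : Prop :=
  4 * ζ * E ≤ lam ∧ Real.log (2 * β / lam) / Real.log (lam / (4 * E)) ≤ h

end

end UNO

/-! Put ε = `ztil + e`. Since ε = `V - fold lam xs`, the target `xs + ε` differs from the estimate
`V` by multiples of `2 * lam`. It is also smooth. Bernstein's inequality for the bandlimited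
filtered signal bounds the `N`-th difference of `xs` by `(T * W) ^ N * β`, and the `N`-th difference
of ε is at most `2 ^ N * E`. `exists_order` finds an `N`, depending only on `lam`, `β`, `h`, for
which the sum stays below `lam`.

These properties determine the target up to a constant. Two candidates differ by `2 * lam * d` with
`d` integer-valued and bounded, and `|Δ^N d| < 1` forces `Δ^N d = 0`. A bounded sequence with
vanishing `N`-th differences is constant, already on a long enough finite window
(`exists_window_const`). So `D` may return any candidate at all, and it is obtained by choice.

The analytic work is Bernstein's inequality with the sharp constant
(`IsBandlimited.exists_hasDerivAt`) and the passage from the L² Fourier transform to absolutely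
convergent integrals (`PaleyWiener.exists_spectrum`, `filtered_eq_fourierInv`). -/

namespace UNO

/-! ### Finite differences and bounded integer sequences -/

/-- The iterated forward difference at `y` only depends on the values at `y, …, y + N h`. -/
theorem fwdDiff_iter_congr {M M' G : Type*} [AddCommMonoid M] [AddCommMonoid M'] [AddCommGroup G]
    (h : M) (h' : M') (f : M → G) (g : M' → G) (N : ℕ) (y : M) (y' : M')
    (H : ∀ i ≤ N, f (y + i • h) = g (y' + i • h')) :
    (fwdDiff h)^[N] f y = (fwdDiff h')^[N] g y' := by
  rw [fwdDiff_iter_eq_sum_shift, fwdDiff_iter_eq_sum_shift]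
  refine Finset.sum_congr rfl fun i hi => ?_
  rw [H i (by simpa [Nat.lt_succ_iff] using hi)]

theorem abs_fwdDiff_iter_le {M : Type*} [AddCommMonoid M] (h : M) (E : ℝ) (N : ℕ) (f : M → ℝ)
    (hf : ∀ k, |f k| ≤ E) (k : M) : |(fwdDiff h)^[N] f k| ≤ 2 ^ N * E := by
  induction N generalizing f E with
  | zero => simpa using hf k
  | succ N ih =>
    rw [Function.iterate_succ_apply]
    have := ih (2 * E) ((fwdDiff h) f) fun j => by
      have h1 := abs_sub (f (j + h)) (f j)
      have h2 := hf (j + h)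
      have h3 := hf j
      simp only [fwdDiff]
      linarith
    calc _ ≤ _ := this
      _ = _ := by ring

theorem fwdDiff_iter_intCast (N : ℕ) (d : ℕ → ℤ) (c : ℝ) (k : ℕ) :
    (fwdDiff 1)^[N] (fun i => c * (d i : ℝ)) k = c * (((fwdDiff 1)^[N] d k : ℤ) : ℝ) := by
  induction N generalizing d with
  | zero => simp
  | succ N ih =>
    rw [Function.iterate_succ_apply, Function.iterate_succ_apply, ← ih]
    refine congrArg (fun f => (fwdDiff 1)^[N] f k) (funext fun i => ?_)
    simp only [fwdDiff]
    push_cast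
    ring

/-- A bounded integer sequence with vanishing `N`-th differences on a long window is constant. -/
theorem exists_window_const (N B : ℕ) : ∃ n₀ : ℕ, 1 ≤ n₀ ∧ ∀ n, n₀ ≤ n → ∀ d : ℕ → ℤ,
    (∀ k < n, |d k| ≤ B) → (∀ k, k + N < n → (fwdDiff 1)^[N] d k = 0) → ∀ k < n, d k = d 0 := by
  induction N generalizing B with
  | zero =>
    refine ⟨1, le_rfl, fun n hn d _ hd k hk => ?_⟩
    have h1 := hd k (by simpa using hk)
    have h2 := hd 0 (by omega)
    simp only [Function.iterate_zero, id_eq] at h1 h2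
    rw [h1, h2]
  | succ N ih =>
    obtain ⟨n₁, hn₁, H⟩ := ih (2 * B)
    -- Differencing costs one sample, hence `n₁ + 1`. The differences turn out constant, so `d` is
    -- affine; a nonzero slope would move it by at least `n - 1 > 2 * B` across the window.
    refine ⟨max (n₁ + 1) (2 * B + 2), by omega, fun n hn d hB hd => ?_⟩
    have hconst := H (n - 1) (by omega) ((fwdDiff 1) d)
      (fun k hk => by
        have h1 := hB (k + 1) (by omega)
        have h2 := hB k (by omega)
        simp only [fwdDiff, abs_le] at *
        push_cast
        omega)
      (fun k hk => by
        have := hd k (by omega)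
        rwa [Function.iterate_succ_apply] at this)
    have hlin : ∀ k < n, d k = d 0 + k * ((fwdDiff 1) d 0) := by
      intro k
      induction k with
      | zero => simp
      | succ k ihk =>
        intro hk
        have h1 := ihk (by omega)
        have h2 := hconst k (by omega)
        have h3 : d (k + 1) = d k + (fwdDiff 1) d k := by simp [fwdDiff]
        rw [h3, h2, h1]
        push_cast
        ring
    have hc : (fwdDiff 1) d 0 = 0 := by
      by_contra hne
      have h1 := hlin (n - 1) (by omega)
      have h2 := hB (n - 1) (by omega)
      have h3 := hB 0 (by omega)
      have h4 : 1 ≤ |(fwdDiff 1) d 0| := Int.one_le_abs hne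
      have h5 : |((n - 1 : ℕ) : ℤ) * (fwdDiff 1) d 0| ≤ 2 * B := by
        rw [show ((n - 1 : ℕ) : ℤ) * (fwdDiff 1) d 0 = d (n - 1) - d 0 by rw [h1]; ring]
        rw [abs_le] at *
        omega
      rw [abs_mul, Nat.abs_cast] at h5
      have h6 : ((n - 1 : ℕ) : ℤ) ≤ ((n - 1 : ℕ) : ℤ) * |(fwdDiff 1) d 0| :=
        le_mul_of_one_le_right (by positivity) h4
      omega
    intro k hk
    rw [hlin k hk, hc]
    ring

/-- Two real sequences that are congruent modulo `2 lam`, bounded by `B`, and have `N`-th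
differences below `lam`, differ by a constant on every long window. -/
theorem exists_window_unique (lam B : ℝ) (hlam : 0 < lam) (N : ℕ) : ∃ n₀ : ℕ, 1 ≤ n₀ ∧
    ∀ n, n₀ ≤ n → ∀ (u w : ℕ → ℝ) (d : ℕ → ℤ), (∀ k < n, w k - u k = 2 * lam * d k) →
    (∀ k < n, |u k| ≤ B) → (∀ k < n, |w k| ≤ B) →
    (∀ k, k + N < n → |(fwdDiff 1)^[N] u k| < lam) →
    (∀ k, k + N < n → |(fwdDiff 1)^[N] w k| < lam) →
    ∀ k < n, d k = d 0 := by
  obtain ⟨n₀, h1, H⟩ := exists_window_const N ⌈B / lam⌉₊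
  refine ⟨n₀, h1, fun n hn u w d hd hu hw hΔu hΔw => H n hn d (fun k hk => ?_) fun k hk => ?_⟩
  · have e1 : |2 * lam * (d k : ℝ)| ≤ 2 * B := by
      rw [← hd k hk]
      linarith [abs_sub (w k) (u k), hu k hk, hw k hk]
    rw [abs_mul, abs_of_pos (by linarith : 0 < 2 * lam)] at e1
    have e2 : |(d k : ℝ)| ≤ B / lam := by
      rw [le_div_iff₀ hlam]
      linarith
    have e3 := e2.trans (Nat.le_ceil _)
    exact_mod_cast e3
  · have e1 : (fwdDiff 1)^[N] (w + (-1 : ℝ) • u) k =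
      (fwdDiff 1)^[N] (fun i => 2 * lam * (d i : ℝ)) k :=
      fwdDiff_iter_congr _ _ _ _ _ _ _ fun i hi => by
        rw [← hd _ (by simp; omega)]
        simp
        ring
    rw [fwdDiff_iter_add, fwdDiff_iter_const_smul, fwdDiff_iter_intCast] at e1
    simp only [Pi.add_apply, Pi.smul_apply, smul_eq_mul] at e1
    have e2 : |2 * lam * (((fwdDiff 1)^[N] d k : ℤ) : ℝ)| < 2 * lam := by
      rw [← e1]
      have := hΔu k hk
      have := hΔw k hk
      rw [abs_lt] at *
      constructor <;> linarith
    rw [abs_mul, abs_of_pos (by linarith : 0 < 2 * lam)] at e2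
    have e3 : |(((fwdDiff 1)^[N] d k : ℤ) : ℝ)| < 1 := by nlinarith
    exact Int.abs_lt_one_iff.mp (by exact_mod_cast e3)

/-! ### Uniqueness of unfoldings -/

/-- Sequences that are congruent to `V` modulo `2 lam`, bounded by `B` and smooth of order `N`. -/
def IsUnfolding (lam B : ℝ) (N : ℕ) (V u : ℤ → ℝ) : Prop :=
  (∀ k, ∃ c : ℤ, u k - V k = 2 * lam * c) ∧ (∀ k, |u k| ≤ B) ∧ ∀ k, |(fwdDiff 1)^[N] u k| < lam

/-- The version of `IsUnfolding` for a window of `n` samples. -/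
def IsWindowUnfolding (lam B : ℝ) (N n : ℕ) (V u : Fin n → ℝ) : Prop :=
  (∀ k, ∃ c : ℤ, u k - V k = 2 * lam * c) ∧ (∀ k, |u k| ≤ B) ∧
    ∃ v : ℕ → ℝ, (∀ k : Fin n, v k = u k) ∧ ∀ k, k + N < n → |(fwdDiff 1)^[N] v k| < lam

theorem IsUnfolding.unique {lam B : ℝ} (hlam : 0 < lam) {N : ℕ} {V u w : ℤ → ℝ}
    (hu : IsUnfolding lam B N V u) (hw : IsUnfolding lam B N V w) :
    ∃ a : ℤ, ∀ k, w k = u k + 2 * lam * a := by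
  obtain ⟨n₀, -, H⟩ := exists_window_unique lam B hlam N
  have hd : ∀ k, ∃ c : ℤ, w k - u k = 2 * lam * c := fun k => by
    obtain ⟨c, hc⟩ := hu.1 k
    obtain ⟨c', hc'⟩ := hw.1 k
    exact ⟨c' - c, by push_cast; linarith⟩
  choose d hd using hd
  have key : ∀ (j : ℤ) (i : ℕ), d (j + i) = d j := fun j i => by
    have hΔ : ∀ (f : ℤ → ℝ), (∀ k, |(fwdDiff 1)^[N] f k| < lam) →
        ∀ k : ℕ, |(fwdDiff 1)^[N] (fun i : ℕ => f (j + i)) k| < lam := fun f hf k => by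
      rw [fwdDiff_iter_congr (1 : ℕ) (1 : ℤ) (fun i : ℕ => f (j + i)) f N k (j + k)
        fun i _ => by simp [add_assoc]]
      exact hf _
    -- A window starting at `j`, long enough for `H` and reaching `j + i`.
    have := H (max n₀ (i + 1)) (le_max_left _ _) (fun i => u (j + i)) (fun i => w (j + i))
      (fun i => d (j + i)) (fun k _ => hd _) (fun k _ => hu.2.1 _) (fun k _ => hw.2.1 _)
      (fun k _ => hΔ u hu.2.2 k) (fun k _ => hΔ w hw.2.2 k) i (by omega)
    simpa using this
  refine ⟨d 0, fun k => ?_⟩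
  have hk : d k = d 0 := by
    rcases le_total 0 k with h | h
    · have := key 0 k.toNat
      rwa [Int.toNat_of_nonneg h, zero_add] at this
    · have := key k (-k).toNat
      rw [Int.toNat_of_nonneg (by omega), add_neg_cancel] at this
      exact this.symm
  rw [← hk]
  linarith [hd k]

theorem IsWindowUnfolding.exists_unique (lam B : ℝ) (hlam : 0 < lam) (N : ℕ) :
    ∃ n₀ : ℕ, ∀ n, n₀ ≤ n → ∀ V u w : Fin n → ℝ, IsWindowUnfolding lam B N n V u →
      IsWindowUnfolding lam B N n V w → ∃ a : ℤ, ∀ k, w k = u k + 2 * lam * a := by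
  obtain ⟨n₀, -, H⟩ := exists_window_unique lam B hlam N
  refine ⟨n₀, fun n hn V u w hu hw => ?_⟩
  -- The extensions `u'`, `w'` are arbitrary outside the window; differences with `k + N < n` do not
  -- see those values.
  obtain ⟨hu1, hu2, u', hu', hu3⟩ := hu
  obtain ⟨hw1, hw2, w', hw', hw3⟩ := hw
  have hd : ∀ k : ℕ, ∃ c : ℤ, k < n → w' k - u' k = 2 * lam * c := fun k => by
    by_cases hk : k < n
    · obtain ⟨c, hc⟩ := hu1 ⟨k, hk⟩
      obtain ⟨c', hc'⟩ := hw1 ⟨k, hk⟩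
      rw [← hu'] at hc
      rw [← hw'] at hc'
      exact ⟨c' - c, fun _ => by push_cast; linarith⟩
    · exact ⟨0, fun h => absurd h hk⟩
  choose d hd using hd
  have := H n hn u' w' d hd (fun k hk => by rw [hu' ⟨k, hk⟩]; exact hu2 _)
    (fun k hk => by rw [hw' ⟨k, hk⟩]; exact hw2 _) hu3 hw3
  refine ⟨d 0, fun k => ?_⟩
  rw [← this k k.2]
  linarith [hd k k.2, hu' k, hw' k]

/-- A choice function for a relation. -/
theorem exists_choice {α β : Type*} [Nonempty β] (C : α → β → Prop) :
    ∃ D : α → β, ∀ V u, C V u → C V (D V) := by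
  classical
  exact ⟨fun V => Classical.epsilon (C V), fun V u h => Classical.epsilon_spec ⟨u, h⟩⟩

/-! ### Choice of the difference order -/

/-- The order of differences that separates the signal from the folding. -/
theorem exists_order (lam β : ℝ) (hlam : 0 < lam) (hβ : 0 < β)
    (hβlam : ∃ b : ℤ, β = 2 * lam * b) (h : ℕ) :
    ∃ N : ℕ, ∀ W T ζ E : ℝ, 0 < W → 0 < T → 1 < ζ → T ≤ 1 / (2 ^ h * W * Real.exp 1) → 0 ≤ E →
      Admissible lam β ζ h E → (T * W) ^ N * β + 2 ^ N * E < lam := by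
  have hβ2 : 1 < 2 * β / lam := by
    obtain ⟨b, rfl⟩ := hβlam
    have hb : 1 ≤ b := by
      by_contra hb
      have : (b : ℝ) ≤ 0 := by exact_mod_cast (by omega : b ≤ 0)
      nlinarith
    have hb' : (1 : ℝ) ≤ b := by exact_mod_cast hb
    rw [lt_div_iff₀ hlam]
    nlinarith
  have hlogβ : 0 < Real.log (2 * β / lam) := Real.log_pos hβ2
  have hTW : ∀ W T : ℝ, 0 < W → T ≤ 1 / (2 ^ h * W * Real.exp 1) →
      T * W ≤ (2 ^ h)⁻¹ * (Real.exp 1)⁻¹ := fun W T hW hT => by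
    calc T * W ≤ 1 / (2 ^ h * W * Real.exp 1) * W := by gcongr
      _ = _ := by field_simp
  have hlogE : ∀ ζ E : ℝ, 1 < ζ → 0 < E → 4 * ζ * E ≤ lam → 1 < lam / (4 * E) :=
    fun ζ E hζ hE hle => by
      rw [lt_div_iff₀ (by linarith)]
      nlinarith
  have hexp : (Real.exp 1)⁻¹ < 1 := inv_lt_one_of_one_lt₀ (by simp)
  rcases Nat.eq_zero_or_pos h with rfl | hh
  · obtain ⟨N, hN⟩ := exists_pow_lt_of_lt_one (show 0 < lam / β by positivity) hexp
    refine ⟨N, fun W T ζ E hW hT0 hζ hT hE hA => ?_⟩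
    -- For `E > 0` the quotient of logarithms is positive and cannot be at most `h = 0`. The noise
    -- term thus disappears, and the factor `1 / e` in `T * W` alone makes the signal term small.
    have hE0 : E = 0 := by
      by_contra hne
      have hEpos : 0 < E := lt_of_le_of_ne hE (Ne.symm hne)
      have h1 := Real.log_pos (hlogE ζ E hζ hEpos hA.1)
      have h2 := hA.2
      have h3 := div_pos hlogβ h1
      simp only [Nat.cast_zero] at h2
      linarith
    have h1 := hTW W T hW hT
    simp only [pow_zero, inv_one, one_mul] at h1
    rw [hE0, mul_zero, add_zero, ← lt_div_iff₀ hβ]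
    exact (pow_le_pow_left₀ (by positivity) h1 N).trans_lt hN
  · have hex : ∃ N : ℕ, 2 * β / lam ≤ (2 ^ h) ^ N := by
      obtain ⟨N, hN⟩ := pow_unbounded_of_one_lt (2 * β / lam)
        (one_lt_pow₀ (by norm_num : (1 : ℝ) < 2) hh.ne')
      exact ⟨N, hN.le⟩
    classical
    -- `N + 1` is the least exponent with `(2 ^ h) ^ (N + 1) ≥ 2 * β / lam`. Reaching the bound
    -- controls the signal, and minimality controls the noise.
    obtain ⟨N, hN, hmin⟩ : ∃ N : ℕ, 2 * β / lam ≤ (2 ^ h) ^ (N + 1) ∧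
        (2 ^ h : ℝ) ^ N < 2 * β / lam := by
      have h0 : Nat.find hex ≠ 0 := fun h0 => by
        have := Nat.find_spec hex
        rw [h0, pow_zero] at this
        linarith
      refine ⟨Nat.find hex - 1, ?_, not_le.mp (Nat.find_min hex (by omega))⟩
      rw [Nat.sub_add_cancel (by omega)]
      exact Nat.find_spec hex
    refine ⟨N + 1, fun W T ζ E hW hT0 hζ hT hE hA => ?_⟩
    have h1 : (T * W) ^ (N + 1) * β < lam / 2 := by
      have e1 : (T * W) ^ (N + 1) ≤ ((2 ^ h : ℝ) ^ (N + 1))⁻¹ * ((Real.exp 1)⁻¹) ^ (N + 1) := by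
        rw [← inv_pow, ← mul_pow]
        exact pow_le_pow_left₀ (by positivity) (hTW W T hW hT) _
      have e2 : ((Real.exp 1)⁻¹) ^ (N + 1) < 1 :=
        pow_lt_one₀ (by positivity) hexp (by omega)
      have e3 : (T * W) ^ (N + 1) < ((2 ^ h : ℝ) ^ (N + 1))⁻¹ :=
        e1.trans_lt (mul_lt_of_lt_one_right (by positivity) e2)
      have e4 : ((2 ^ h : ℝ) ^ (N + 1))⁻¹ ≤ (2 * β / lam)⁻¹ := inv_anti₀ (by linarith) hN
      calc (T * W) ^ (N + 1) * β < (2 * β / lam)⁻¹ * β := by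
            gcongr
            exact e3.trans_le e4
        _ = lam / 2 := by field_simp
    have h2 : 2 ^ (N + 1) * E ≤ lam / 2 := by
      rcases hE.eq_or_lt with rfl | hEpos
      · rw [mul_zero]
        exact (half_pos hlam).le
      have e1 := hlogE ζ E hζ hEpos hA.1
      have e2 := Real.log_pos e1
      have e3 := hA.2
      rw [div_le_iff₀ e2, ← Real.log_pow] at e3
      have e4 := (Real.log_le_log_iff (by linarith) (by positivity)).mp e3
      -- Taking `h`-th roots gives `2 ^ N < lam / (4 * E)`; this leaves half of `lam` for the noise.
      have e5 : ((2 : ℝ) ^ N) ^ h < (lam / (4 * E)) ^ h := by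
        rw [← pow_mul, mul_comm N h, pow_mul]
        exact hmin.trans_le e4
      have e6 := lt_of_pow_lt_pow_left₀ h (by positivity) e5
      rw [lt_div_iff₀ (by linarith)] at e6
      rw [pow_succ]
      linarith
    linarith

/-! ### Fourier series of the triangle wave -/

theorem hasSum_inv_sq_mul_cos {x : ℝ} (hx : x ∈ Icc (0 : ℝ) 1) :
    HasSum (fun n : ℕ => 1 / (n : ℝ) ^ 2 * Real.cos (2 * Real.pi * n * x))
      (Real.pi ^ 2 * (x ^ 2 - x + 1 / 6)) := by
  convert! hasSum_one_div_nat_pow_mul_cos one_ne_zero hx using 1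
  have := bernoulliFun_two x
  unfold bernoulliFun at this
  rw [mul_one, this]
  norm_num
  left
  ring

/-- The even-indexed terms of the full series are a quarter of the same series at `2 * x`, which
must lie in `[0, 1]`; subtracting them leaves the odd ones. -/
theorem hasSum_inv_odd_sq_mul_cos {x : ℝ} (hx : x ∈ Icc (0 : ℝ) (1 / 2)) :
    HasSum (fun j : ℕ => 1 / (2 * j + 1 : ℝ) ^ 2 * Real.cos (2 * Real.pi * (2 * j + 1) * x))
      (Real.pi ^ 2 * (1 / 8 - x / 2)) := by
  have h1 := hasSum_inv_sq_mul_cos (x := x) ⟨hx.1, by linarith [hx.2]⟩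
  have h2 := hasSum_inv_sq_mul_cos (x := 2 * x) ⟨by linarith [hx.1], by linarith [hx.2]⟩
  set f : ℕ → ℝ := fun n => 1 / (n : ℝ) ^ 2 * Real.cos (2 * Real.pi * n * x) with hf
  have he : HasSum (fun n : ℕ => f (2 * n))
      (1 / 4 * (Real.pi ^ 2 * ((2 * x) ^ 2 - 2 * x + 1 / 6))) := by
    refine (h2.mul_left (1 / 4)).congr_fun fun n => ?_
    simp only [hf]
    push_cast
    rw [show 2 * Real.pi * (2 * n) * x = 2 * Real.pi * n * (2 * x) by ring, mul_pow, one_div,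
      one_div, mul_inv]
    ring
  have ho : HasSum (fun j : ℕ => f (2 * j + 1)) (∑' j : ℕ, f (2 * j + 1)) :=
    (h1.summable.comp_injective (i := fun j : ℕ => 2 * j + 1)
      fun a b hab => by simpa using hab).hasSum
  have h3 := (he.even_add_odd ho).unique h1
  have h4 : ∑' j : ℕ, f (2 * j + 1) = Real.pi ^ 2 * (1 / 8 - x / 2) := by linarith
  rw [h4] at ho
  refine ho.congr_fun fun j => ?_
  simp only [hf]
  push_cast
  rfl

/-- The Fourier series of the triangle wave. -/
theorem hasSum_triangle {θ : ℝ} (hθ : |θ| ≤ 1) :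
    HasSum (fun j : ℕ => 1 / (2 * j + 1 : ℝ) ^ 2 *
      Real.cos ((2 * j + 1) * (Real.pi / 2) * (1 - θ))) (Real.pi ^ 2 / 8 * θ) := by
  rw [abs_le] at hθ
  have := hasSum_inv_odd_sq_mul_cos (x := (1 - θ) / 4) ⟨by linarith, by linarith⟩
  rw [show Real.pi ^ 2 * (1 / 8 - (1 - θ) / 4 / 2) = Real.pi ^ 2 / 8 * θ by ring] at this
  refine this.congr_fun fun j => ?_
  ring_nf

theorem hasSum_inv_odd_sq : HasSum (fun j : ℕ => 1 / (2 * j + 1 : ℝ) ^ 2) (Real.pi ^ 2 / 8) := by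
  simpa using hasSum_triangle (θ := 1) (by simp)

/-! ### Bernstein's inequality -/

/-- Fourier transforms of integrable functions that vanish outside `[-W, W]`
(angular frequency). -/
def IsBandlimited (W : ℝ) (y : ℝ → ℂ) : Prop :=
  ∃ G : ℝ → ℂ, Integrable G ∧ (∀ ξ, W < |2 * Real.pi * ξ| → G ξ = 0) ∧ y = 𝓕 G

theorem fourier_real_exp (G : ℝ → ℂ) (t : ℝ) :
    𝓕 G t = ∫ ξ : ℝ, Complex.exp (((-2 * Real.pi * ξ * t : ℝ) : ℂ) * Complex.I) * G ξ := by
  rw [Real.fourier_eq']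
  simp only [smul_eq_mul]
  refine integral_congr_ae (.of_forall fun ξ => ?_)
  simp only [RCLike.inner_apply, conj_trivial]
  congr 4
  ring

theorem integrable_exp_mul {G : ℝ → ℂ} (hG : Integrable G) (a : ℝ) :
    Integrable fun ξ : ℝ => Complex.exp (((a * ξ : ℝ) : ℂ) * Complex.I) * G ξ := by
  refine hG.bdd_mul (c := 1) (by fun_prop) (.of_forall fun ξ => ?_)
  rw [Complex.norm_exp_ofReal_mul_I]

theorem fourier_exp_mul (G : ℝ → ℂ) (a t : ℝ) :
    𝓕 (fun ξ : ℝ => Complex.exp (((-2 * Real.pi * a * ξ : ℝ) : ℂ) * Complex.I) * G ξ) t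
      = 𝓕 G (t + a) := by
  rw [fourier_real_exp, fourier_real_exp]
  refine integral_congr_ae (.of_forall fun ξ => ?_)
  simp only
  rw [← mul_assoc, ← Complex.exp_add]
  congr 2
  push_cast
  ring

/-- A shift multiplies the spectrum by a unimodular exponential and keeps its support, so the
estimate for one difference can be iterated. -/
theorem IsBandlimited.sub_shift {W : ℝ} {y : ℝ → ℂ} (hy : IsBandlimited W y) (T : ℝ) :
    IsBandlimited W (fun t => y (t + T) - y t) := by
  obtain ⟨G, hG, hs, rfl⟩ := hy
  have h1 := integrable_exp_mul hG (-2 * Real.pi * T)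
  refine ⟨(fun ξ : ℝ => Complex.exp (((-2 * Real.pi * T * ξ : ℝ) : ℂ) * Complex.I) * G ξ) - G,
    h1.sub hG, fun ξ hξ => by simp [hs ξ hξ], ?_⟩
  ext t
  rw [← fourier_exp_mul, fourier_real_exp, fourier_real_exp, fourier_real_exp, ← integral_sub]
  · refine integral_congr_ae (.of_forall fun ξ => ?_)
    simp only [Pi.sub_apply]
    ring
  · have := integrable_exp_mul h1 (-2 * Real.pi * t)
    refine this.congr (.of_forall fun ξ => ?_)
    simp only
    congr 4
    ring
  · refine (integrable_exp_mul hG (-2 * Real.pi * t)).congr (.of_forall fun ξ => ?_)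
    simp only
    congr 4
    ring

/-- Bernstein's inequality, by the interpolation formula of M. Riesz. -/
theorem IsBandlimited.exists_hasDerivAt {W B : ℝ} (hW : 0 < W) {y : ℝ → ℂ}
    (hy : IsBandlimited W y) (hB : ∀ t, ‖y t‖ ≤ B) (t : ℝ) :
    ∃ y', HasDerivAt y y' t ∧ ‖y'‖ ≤ W * B := by
  obtain ⟨G, hG, hs, rfl⟩ := hy
  have hπ := Real.pi_pos
  have hbd : ∀ ξ, G ξ ≠ 0 → |2 * Real.pi * ξ / W| ≤ 1 := fun ξ hξ => by
    rw [abs_div, abs_of_pos hW, div_le_one hW]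
    by_contra h
    exact hξ (hs ξ (not_le.mp h))
  have hG' : Integrable fun ξ : ℝ => ξ • G ξ := by
    refine (hG.norm.const_mul (W / (2 * Real.pi))).mono'
      (continuous_id.aestronglyMeasurable.smul hG.1) (.of_forall fun ξ => ?_)
    by_cases h : G ξ = 0
    · simp [h]
    have := hbd ξ h
    rw [norm_smul, Real.norm_eq_abs]
    gcongr
    rw [abs_div, abs_of_pos hW, div_le_one hW, abs_mul, abs_of_pos (by positivity)] at this
    rw [le_div_iff₀ (by positivity)]
    linarith
  refine ⟨_, Real.hasDerivAt_fourier hG hG' t, ?_⟩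
  set H : ℝ → ℂ := fun ξ => Complex.exp (((-2 * Real.pi * t * ξ : ℝ) : ℂ) * Complex.I) * G ξ
    with hH
  have hHi : Integrable H := integrable_exp_mul hG _
  have hFH : ∀ a, ‖∫ ξ : ℝ, Complex.exp (((-2 * Real.pi * a * ξ : ℝ) : ℂ) * Complex.I) * H ξ‖
      ≤ B := fun a => by
    refine le_of_eq_of_le ?_ (hB (a + t))
    rw [← fourier_exp_mul G t a, fourier_real_exp]
    congr 2
    ext ξ
    rw [hH]
    congr 4
    ring
  -- On the support of `G`, θ = `2 * π * ξ / W` lies in `[-1, 1]`, so the factor ξ produced by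
  -- differentiation can be replaced by the triangle-wave series in θ. Its coefficients are
  -- nonnegative with sum `π ^ 2 / 8`, which yields the sharp constant.
  set c : ℕ → ℝ := fun j => 1 / (2 * j + 1 : ℝ) ^ 2 with hc
  have hc0 : ∀ j, 0 ≤ c j := fun j => by positivity
  set F : ℕ → ℝ → ℂ := fun j ξ =>
    ((c j * Real.cos ((2 * j + 1) * (Real.pi / 2) * (1 - 2 * Real.pi * ξ / W)) : ℝ) : ℂ) * H ξ
    with hF
  have hFn : ∀ j ξ, ‖F j ξ‖ ≤ c j * ‖H ξ‖ := fun j ξ => by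
    rw [hF, norm_mul, Complex.norm_real, norm_mul, Real.norm_of_nonneg (hc0 j)]
    gcongr
    exact mul_le_of_le_one_right (hc0 j) (Real.abs_cos_le_one _)
  have hFi : ∀ j, Integrable (F j) := fun j =>
    (hHi.norm.const_mul (c j)).mono' (by
      refine AEStronglyMeasurable.mul (Continuous.aestronglyMeasurable ?_) hHi.1
      fun_prop) (.of_forall (hFn j))
  have hsum := hasSum_integral_of_summable_integral_norm hFi (by
    refine Summable.of_nonneg_of_le (fun j => by positivity) (fun j => ?_)
      (hasSum_inv_odd_sq.summable.mul_right (∫ ξ, ‖H ξ‖))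
    rw [← integral_const_mul]
    exact integral_mono (hFi j).norm (hHi.norm.const_mul _) (hFn j))
  have htsum : ∀ ξ, ∑' j, F j ξ =
      ((Real.pi ^ 2 / 8 * (2 * Real.pi * ξ / W) : ℝ) : ℂ) * H ξ := fun ξ => by
    by_cases h : G ξ = 0
    · simp [hF, hH, h]
    · exact ((Complex.hasSum_ofReal.mpr (hasSum_triangle (hbd ξ h))).mul_right (H ξ)).tsum_eq
  simp only [htsum] at hsum
  have hterm : ∀ j, ‖∫ ξ, F j ξ‖ ≤ c j * B := fun j => by
    set b : ℝ := (2 * j + 1) * (Real.pi / 2) with hb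
    -- Each cosine is half a sum of two exponentials, so the integral of `F j` combines the values
    -- of `y` at `t ± b / W`, with weights of modulus `c j / 2`.
    have hFe : ∀ ξ, F j ξ = (c j / 2 : ℂ) * (Complex.exp ((b : ℝ) * Complex.I) *
        (Complex.exp (((-2 * Real.pi * (b / W) * ξ : ℝ) : ℂ) * Complex.I) * H ξ)) +
        (c j / 2 : ℂ) * (Complex.exp ((-b : ℝ) * Complex.I) *
        (Complex.exp (((-2 * Real.pi * (-(b / W)) * ξ : ℝ) : ℂ) * Complex.I) * H ξ)) := by
      intro ξ
      simp only [hF]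
      rw [Complex.ofReal_mul, Complex.ofReal_cos, Complex.cos]
      have e1 : Complex.exp (((b * (1 - 2 * Real.pi * ξ / W) : ℝ) : ℂ) * Complex.I) =
          Complex.exp ((b : ℝ) * Complex.I) *
            Complex.exp (((-2 * Real.pi * (b / W) * ξ : ℝ) : ℂ) * Complex.I) := by
        rw [← Complex.exp_add]
        congr 1
        push_cast
        ring
      have e2 : Complex.exp (-((b * (1 - 2 * Real.pi * ξ / W) : ℝ) : ℂ) * Complex.I) =
          Complex.exp ((-b : ℝ) * Complex.I) *
            Complex.exp (((-2 * Real.pi * (-(b / W)) * ξ : ℝ) : ℂ) * Complex.I) := by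
        rw [← Complex.exp_add]
        congr 1
        push_cast
        ring
      rw [e1, e2]
      ring
    have hi : ∀ a, Integrable fun ξ : ℝ =>
        Complex.exp (((-2 * Real.pi * a * ξ : ℝ) : ℂ) * Complex.I) * H ξ :=
      fun a => integrable_exp_mul hHi _
    simp only [hFe]
    rw [integral_add (((hi _).const_mul _).const_mul _) (((hi _).const_mul _).const_mul _)]
    simp only [integral_const_mul]
    refine (norm_add_le _ _).trans ?_
    have hcn : ‖(c j / 2 : ℂ)‖ = c j / 2 := by
      rw [norm_div, Complex.norm_real, Real.norm_of_nonneg (hc0 j)]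
      simp
    rw [norm_mul, norm_mul, norm_mul, norm_mul, Complex.norm_exp_ofReal_mul_I,
      Complex.norm_exp_ofReal_mul_I, hcn, one_mul, one_mul]
    have h1 := mul_le_mul_of_nonneg_left (hFH (b / W)) (div_nonneg (hc0 j) two_pos.le)
    have h2 := mul_le_mul_of_nonneg_left (hFH (-(b / W))) (div_nonneg (hc0 j) two_pos.le)
    linarith
  have hnorm : ‖∫ ξ : ℝ, ((Real.pi ^ 2 / 8 * (2 * Real.pi * ξ / W) : ℝ) : ℂ) * H ξ‖ ≤
      Real.pi ^ 2 / 8 * B := by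
    rw [← hsum.tsum_eq]
    exact tsum_of_norm_bounded (hasSum_inv_odd_sq.mul_right B) hterm
  have hD : 𝓕 (fun x : ℝ => (-2 * Real.pi * Complex.I * x) • G x) t =
      (-Complex.I * (W * 8 / Real.pi ^ 2 : ℝ)) *
      ∫ ξ : ℝ, ((Real.pi ^ 2 / 8 * (2 * Real.pi * ξ / W) : ℝ) : ℂ) * H ξ := by
    rw [fourier_real_exp, ← integral_const_mul]
    refine integral_congr_ae (.of_forall fun ξ => ?_)
    simp only [hH, smul_eq_mul]
    rw [show -2 * Real.pi * ξ * t = -2 * Real.pi * t * ξ by ring]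
    have : (Real.pi : ℂ) ≠ 0 := by exact_mod_cast hπ.ne'
    have : (W : ℂ) ≠ 0 := by exact_mod_cast hW.ne'
    push_cast
    field_simp
  rw [hD, norm_mul, norm_mul, norm_neg, Complex.norm_I, one_mul, Complex.norm_real,
    Real.norm_of_nonneg (by positivity)]
  calc _ ≤ W * 8 / Real.pi ^ 2 * (Real.pi ^ 2 / 8 * B) := by gcongr
    _ = W * B := by field_simp

theorem IsBandlimited.norm_sub_shift_le {W B T : ℝ} (hW : 0 < W) (hT : 0 ≤ T) {y : ℝ → ℂ}
    (hy : IsBandlimited W y) (hB : ∀ t, ‖y t‖ ≤ B) (t : ℝ) : ‖y (t + T) - y t‖ ≤ T * W * B := by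
  choose y' hy' hbd using hy.exists_hasDerivAt hW hB
  have := convex_univ.norm_image_sub_le_of_norm_hasDerivWithin_le (f := y) (f' := y')
    (fun x _ => (hy' x).hasDerivWithinAt) (fun x _ => hbd x) (mem_univ t) (mem_univ (t + T))
  rw [add_sub_cancel_left, Real.norm_of_nonneg hT] at this
  linarith

theorem IsBandlimited.norm_fwdDiff_iter_le {W B T : ℝ} (hW : 0 < W) (hT : 0 ≤ T) {y : ℝ → ℂ}
    (hy : IsBandlimited W y) (hB : ∀ t, ‖y t‖ ≤ B) (N : ℕ) (t : ℝ) :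
    ‖(fwdDiff T)^[N] y t‖ ≤ (T * W) ^ N * B := by
  induction N generalizing y B with
  | zero => simpa using hB t
  | succ N ih =>
    rw [Function.iterate_succ_apply]
    refine (ih (y := fwdDiff T y) (hy.sub_shift T) (hy.norm_sub_shift_le hW hT hB)).trans_eq ?_
    ring

/-! ### The L² Fourier transform and Fourier integrals -/

open scoped ComplexConjugate SchwartzMap

theorem integral_fourier_mul_flip {f g : ℝ → ℂ} (hf : Integrable f) (hg : Integrable g) :
    ∫ ξ, 𝓕 f ξ * g ξ = ∫ t, f t * 𝓕 g t := by
  have := VectorFourier.integral_fourierIntegral_smul_eq_flip (L := innerₗ ℝ)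
    Real.continuous_fourierChar continuous_inner hf hg
  rw [flip_innerₗ] at this
  simpa only [smul_eq_mul] using! this

theorem integral_fourierInv_mul_flip {f g : ℝ → ℂ} (hf : Integrable f) (hg : Integrable g) :
    ∫ ξ, 𝓕⁻ f ξ * g ξ = ∫ t, f t * 𝓕⁻ g t := by
  rw [Real.fourierInv_eq_fourier_comp_neg f, integral_fourier_mul_flip hf.comp_neg hg,
    ← integral_neg_eq_self]
  simp [Real.fourierInv_eq_fourier_neg]

/-- The Fourier transform of square-integrable functions is given by the Fourier integral
for integrable functions. -/
theorem fourier_toLp_eq {F f : ℝ → ℂ} (hF : Integrable F) (hF2 : MemLp F 2) (hf : MemLp f 2)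
    (h : ∀ t, f t = 𝓕 F t) : 𝓕 (hF2.toLp F) = hf.toLp f := by
  -- An L² function is determined by its tempered distribution, and there the transform moves onto
  -- the test function.
  have hinj := LinearMap.ker_eq_bot.mp
    (Lp.ker_toTemperedDistributionCLM_eq_bot (F := ℂ) (E := ℝ) (μ := volume) (p := 2))
  apply hinj
  change Lp.toTemperedDistribution _ = Lp.toTemperedDistribution _
  rw [← Lp.fourier_toTemperedDistribution_eq]
  ext ψ
  rw [TemperedDistribution.fourier_apply, Lp.toTemperedDistribution_apply,
    Lp.toTemperedDistribution_apply]
  have e1 : ∫ x, (𝓕 ψ) x • (hF2.toLp F) x = ∫ x, 𝓕 (ψ : ℝ → ℂ) x * F x := by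
    refine integral_congr_ae ?_
    filter_upwards [hF2.coeFn_toLp] with x hx
    rw [hx, SchwartzMap.fourier_coe, smul_eq_mul]
  have e2 : ∫ x, ψ x • (hf.toLp f) x = ∫ x, ψ x * 𝓕 F x := by
    refine integral_congr_ae ?_
    filter_upwards [hf.coeFn_toLp] with x hx
    rw [hx, h, smul_eq_mul]
  rw [e1, e2, integral_fourier_mul_flip ψ.integrable hF]

theorem continuous_fourierInv {G : ℝ → ℂ} (hG : Integrable G) : Continuous (𝓕⁻ G) := by
  have h : Continuous (𝓕 G) := VectorFourier.fourierIntegral_continuous (L := innerₗ ℝ)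
    Real.continuous_fourierChar continuous_inner hG
  have : 𝓕⁻ G = fun t => 𝓕 G (-t) := funext fun t => Real.fourierInv_eq_fourier_neg G t
  rw [this]
  exact h.comp continuous_neg

/-- Fourier inversion for continuous square-integrable functions with an integrable Fourier
transform. -/
theorem eq_fourierInv_of_fourier_ae_eq {f G : ℝ → ℂ} (hfc : Continuous f) (hf : MemLp f 2)
    (hG : Integrable G) (h : (𝓕 (hf.toLp f) : Lp ℂ 2 (volume : Measure ℝ)) =ᵐ[volume] G) :
    f = 𝓕⁻ G := by
  refine Continuous.ae_eq_iff_eq volume hfc (continuous_fourierInv hG) |>.mp ?_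
  refine ae_eq_of_integral_contDiff_smul_eq hfc.locallyIntegrable
    (continuous_fourierInv hG).locallyIntegrable fun g hg hgc => ?_
  have hg₁ : HasCompactSupport (Complex.ofRealCLM ∘ g) := hgc.comp_left rfl
  have hg₂ : ContDiff ℝ ((⊤ : ℕ∞) : WithTop ℕ∞) (Complex.ofRealCLM ∘ g) := by fun_prop
  set ψ : 𝓢(ℝ, ℂ) := hg₁.toSchwartzMap hg₂ with hψ
  have hψg : ∀ x, ψ x = (g x : ℂ) := fun x => rfl
  have key := congrArg (fun S => S ψ)
    (Lp.fourierInv_toTemperedDistribution_eq (𝓕 (hf.toLp f)))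
  simp only [FourierTransform.fourierInv_fourier_eq] at key
  rw [TemperedDistribution.fourierInv_apply, Lp.toTemperedDistribution_apply,
    Lp.toTemperedDistribution_apply] at key
  have e1 : ∫ x, (𝓕⁻ ψ) x • (𝓕 (hf.toLp f) : Lp ℂ 2 (volume : Measure ℝ)) x =
      ∫ x, 𝓕⁻ (ψ : ℝ → ℂ) x * G x := by
    refine integral_congr_ae ?_
    filter_upwards [h] with x hx
    rw [hx, SchwartzMap.fourierInv_coe, smul_eq_mul]
  have e2 : ∫ x, ψ x • (hf.toLp f) x = ∫ x, g x • f x := by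
    refine integral_congr_ae ?_
    filter_upwards [hf.coeFn_toLp] with x hx
    rw [hx, hψg, smul_eq_mul, Complex.real_smul]
  rw [e1, e2, integral_fourierInv_mul_flip ψ.integrable hG] at key
  rw [← key]
  simp only [hψg, Complex.real_smul]

/-! ### Paley-Wiener signals and the filter -/

/-- The frequencies in `[-W, W]`. -/
def band (W : ℝ) : Set ℝ := {ξ | |2 * Real.pi * ξ| ≤ W}

theorem band_eq_Icc (W : ℝ) : band W = Icc (-(W / (2 * Real.pi))) (W / (2 * Real.pi)) := by
  ext ξ
  have hπ := Real.pi_pos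
  have : |2 * Real.pi * ξ| = 2 * Real.pi * |ξ| := by
    rw [abs_mul, abs_of_pos (by positivity)]
  rw [band, mem_ofPred_eq, this, mem_Icc, ← abs_le, le_div_iff₀ (by positivity), mul_comm]

theorem measurableSet_band (W : ℝ) : MeasurableSet (band W) := by
  rw [band_eq_Icc]
  exact measurableSet_Icc

theorem volume_band_ne_top (W : ℝ) : volume (band W) ≠ ⊤ := by
  rw [band_eq_Icc]
  exact measure_Icc_lt_top.ne

/-- The signals in the Paley-Wiener space are inverse Fourier integrals over the band. -/
theorem PaleyWiener.exists_spectrum {W : ℝ} {f : ℝ → ℝ} (hf : PaleyWiener W f) :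
    ∃ X : ℝ → ℂ, Integrable X ∧ MemLp X 2 ∧ (∀ ξ, ξ ∉ band W → X ξ = 0) ∧
      ∀ t, (f t : ℂ) = 𝓕⁻ X t := by
  obtain ⟨hc, hf2, h⟩ := hf
  set Y := 𝓕 (hf2.toLp (fun t : ℝ => (f t : ℂ))) with hY
  have hYm : MemLp Y 2 := Lp.memLp Y
  have hae : Y =ᵐ[volume] (band W).indicator Y := by
    filter_upwards [h] with ξ hξ
    by_cases hb : ξ ∈ band W
    · rw [indicator_of_mem hb]
    · rw [indicator_of_notMem hb, hξ (not_le.mp hb)]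
  -- The band has finite measure, so the L² spectrum is integrable there. Passing to the indicator
  -- turns vanishing a.e. into vanishing everywhere off the band.
  have hYi : Integrable ((band W).indicator Y) := by
    rw [integrable_indicator_iff (measurableSet_band W)]
    have : IsFiniteMeasure (volume.restrict (band W)) :=
      ⟨by rw [Measure.restrict_apply_univ]; exact (volume_band_ne_top W).lt_top⟩
    exact (hYm.restrict (band W)).integrable (by norm_num)
  refine ⟨(band W).indicator Y, hYi, hYm.indicator (measurableSet_band W),
    fun ξ hξ => indicator_of_notMem hξ _, fun t => ?_⟩
  exact congrFun (eq_fourierInv_of_fourier_ae_eq (by fun_prop) hf2 hYi hae) t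

theorem filterable_of_memLp {φ f : ℝ → ℝ} (hφ : MemLp φ 2) (hf : MemLp f 2) : Filterable φ f := by
  intro t
  have : MemLp (fun s => φ (t - s)) 2 :=
    hφ.comp_measurePreserving (Measure.measurePreserving_sub_left volume t)
  exact hf.integrable_mul this

theorem PaleyWiener.memLp {W : ℝ} {f : ℝ → ℝ} (hf : PaleyWiener W f) : MemLp f 2 := by
  obtain ⟨-, hf2, -⟩ := hf
  exact hf2.re

theorem filtered_add {φ f g : ℝ → ℝ} (hf : Filterable φ f) (hg : Filterable φ g) :
    filtered φ (f + g) = filtered φ f + filtered φ g :=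
  ConvolutionExists.add_distrib hf hg

/-- The transfer formula of the filter. -/
theorem filtered_eq_fourierInv {φ f : ℝ → ℝ} (hφ : MemLp (fun t => (φ t : ℂ)) 2)
    (hf : MemLp (fun t => (f t : ℂ)) 2) {X : ℝ → ℂ} (hX : Integrable X) (hX2 : MemLp X 2)
    (hfX : ∀ t, (f t : ℂ) = 𝓕⁻ X t) (t : ℝ) :
    (filtered φ f t : ℂ) =
      𝓕⁻ (fun ξ => conj ((𝓕⁻ (hφ.toLp _) : Lp ℂ 2 (volume : Measure ℝ)) ξ) * X ξ) t := by
  set e : ℝ → ℂ := fun ξ => Complex.exp (((2 * Real.pi * t * ξ : ℝ) : ℂ) * Complex.I) with he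
  have hec : Continuous e := by fun_prop
  have hen : ∀ ξ, ‖e ξ‖ = 1 := fun ξ => Complex.norm_exp_ofReal_mul_I _
  have hh2 : MemLp (fun s => (f (t - s) : ℂ)) 2 :=
    hf.comp_measurePreserving (Measure.measurePreserving_sub_left volume t)
  have hE : Integrable (fun ξ => e ξ * X ξ) := integrable_exp_mul hX _
  have hE2 : MemLp (fun ξ => e ξ * X ξ) 2 :=
    hX2.of_le (hec.aestronglyMeasurable.mul hX2.1) (.of_forall fun ξ => by
      rw [norm_mul, hen, one_mul])
  have hF : 𝓕 (hE2.toLp _) = hh2.toLp _ := fourier_toLp_eq hE hE2 hh2 fun s => by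
    rw [hfX, Real.fourierInv_eq_fourier_neg, fourier_real_exp, fourier_real_exp]
    refine integral_congr_ae (.of_forall fun ξ => ?_)
    simp only [he]
    rw [← mul_assoc, ← Complex.exp_add]
    congr 2
    push_cast
    ring
  -- As `φ` is real, the convolution at `t` is the inner product of `φ` with `f (t - ·)`, the
  -- Fourier transform of `e * X` by `hF`; Plancherel moves it to the frequency side.
  have h1 : (filtered φ f t : ℂ) = inner ℂ (hφ.toLp _) (hh2.toLp _) := by
    rw [L2.inner_def, filtered, convolution_def, ← integral_sub_left_eq_self _ volume t,
      ← integral_complex_ofReal]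
    refine integral_congr_ae ?_
    filter_upwards [hφ.coeFn_toLp, hh2.coeFn_toLp] with s h1 h2
    rw [h1, h2]
    simp
  have h2 : hφ.toLp (fun t => (φ t : ℂ)) =
      𝓕 (𝓕⁻ (hφ.toLp (fun t => (φ t : ℂ))) : Lp ℂ 2 (volume : Measure ℝ)) :=
    (FourierTransform.fourier_fourierInv_eq _).symm
  rw [h1, ← hF]
  conv_lhs => rw [h2]
  rw [Lp.inner_fourier_eq, L2.inner_def, Real.fourierInv_eq_fourier_neg, fourier_real_exp]
  refine integral_congr_ae ?_
  filter_upwards [hE2.coeFn_toLp] with ξ h2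
  rw [h2]
  simp only [RCLike.inner_apply, he]
  rw [show -2 * Real.pi * ξ * -t = 2 * Real.pi * t * ξ by ring]
  ring

/-- The ideal low-pass filter is the Fourier transform of the indicator of the band. -/
theorem idealLowPass_eq_fourier {W : ℝ} (hW : 0 < W) (t : ℝ) :
    (idealLowPass W t : ℂ) = 𝓕 ((band W).indicator fun _ => (1 : ℂ)) t := by
  have hπ := Real.pi_pos
  rw [fourier_real_exp, band_eq_Icc]
  set a := W / (2 * Real.pi) with ha
  have ha0 : 0 < a := by positivity
  have h1 : ∀ ξ : ℝ, Complex.exp (((-2 * Real.pi * ξ * t : ℝ) : ℂ) * Complex.I) *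
      (Icc (-a) a).indicator (fun _ => (1 : ℂ)) ξ =
      (Icc (-a) a).indicator
        (fun ξ : ℝ => Complex.exp (((-2 * Real.pi * ξ * t : ℝ) : ℂ) * Complex.I)) ξ := fun ξ => by
    by_cases h : ξ ∈ Icc (-a) a <;> simp [h]
  simp only [h1]
  rw [integral_indicator measurableSet_Icc, integral_Icc_eq_integral_Ioc,
    ← intervalIntegral.integral_of_le (by linarith)]
  have hWa : W = 2 * Real.pi * a := by rw [ha]; field_simp
  rcases eq_or_ne t 0 with rfl | ht
  · simp only [idealLowPass, mul_zero, Real.sinc_zero, Complex.ofReal_zero, zero_mul,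
      Complex.exp_zero, intervalIntegral.integral_const, hWa, Complex.real_smul, mul_one]
    norm_cast
    field_simp
    ring
  · have h2 : ∀ ξ : ℝ, Complex.exp (((-2 * Real.pi * ξ * t : ℝ) : ℂ) * Complex.I) =
        (fun u : ℝ => Complex.exp (u * Complex.I)) ((-2 * Real.pi * t) * ξ) := fun ξ => by
      simp only
      congr 3
      ring
    simp only [h2]
    rw [intervalIntegral.integral_comp_mul_left
      (fun u : ℝ => Complex.exp (u * Complex.I)) (c := -2 * Real.pi * t) (by
        have := hπ.ne'
        positivity)]
    rw [show -2 * Real.pi * t * -a = - (-(W * t)) by rw [hWa]; ring,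
      show -2 * Real.pi * t * a = -(W * t) by rw [hWa]; ring,
      integral_exp_mul_I_eq_sinc, idealLowPass, Real.sinc_neg, Complex.real_smul]
    have : (t : ℂ) ≠ 0 := by exact_mod_cast ht
    push_cast
    field_simp

/-- The ideal low-pass filter leaves the Paley-Wiener space fixed. -/
theorem filtered_idealLowPass {W : ℝ} (hW : 0 < W) {f : ℝ → ℝ} (hf : PaleyWiener W f)
    (hφ : PaleyWiener W (idealLowPass W)) : filtered (idealLowPass W) f = f := by
  obtain ⟨X, hX, hX2, hXs, hfX⟩ := hf.exists_spectrum
  obtain ⟨-, hφ2, -⟩ := hφ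
  have hI : Integrable ((band W).indicator fun _ => (1 : ℂ)) :=
    (integrable_indicator_iff (measurableSet_band W)).mpr
      (integrableOn_const (volume_band_ne_top W))
  have hI2 : MemLp ((band W).indicator fun _ => (1 : ℂ)) 2 :=
    memLp_indicator_const 2 (measurableSet_band W) 1 (Or.inr (volume_band_ne_top W))
  have hφF := fourier_toLp_eq hI hI2 hφ2 (idealLowPass_eq_fourier hW)
  have hφI : 𝓕⁻ (hφ2.toLp _) = hI2.toLp _ := by
    rw [← hφF, FourierTransform.fourierInv_fourier_eq]
  ext t
  have h := filtered_eq_fourierInv hφ2 hf.2.choose hX hX2 hfX t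
  rw [← Complex.ofReal_inj, h, hfX, Real.fourierInv_eq_fourier_neg,
    Real.fourierInv_eq_fourier_neg]
  refine Real.fourier_congr_ae ?_ _
  rw [hφI]
  filter_upwards [hI2.coeFn_toLp] with ξ hξ
  rw [hξ]
  by_cases hb : ξ ∈ band W
  · simp [hb]
  · simp [hXs ξ hb]

/-- The spectrum is a product of two L² functions, hence integrable, and it inherits its support
from `X`. The reflection `ξ ↦ -ξ` turns the inverse transform into `𝓕`. -/
theorem isBandlimited_filtered {W : ℝ} {φ f : ℝ → ℝ} (hφ : PaleyWiener W φ)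
    (hf : PaleyWiener W f) : IsBandlimited W (fun t => (filtered φ f t : ℂ)) := by
  obtain ⟨X, hX, hX2, hXs, hfX⟩ := hf.exists_spectrum
  obtain ⟨-, hφ2, -⟩ := hφ
  set Φ : Lp ℂ 2 (volume : Measure ℝ) := 𝓕⁻ (hφ2.toLp _) with hΦ
  have hG : Integrable fun ξ => conj (Φ ξ) * X ξ := (Lp.memLp Φ).star.integrable_mul hX2
  refine ⟨fun ξ => conj (Φ (-ξ)) * X (-ξ), hG.comp_neg, fun ξ hξ => ?_, ?_⟩
  · beta_reduce
    rw [hXs (-ξ) (by rw [band, mem_ofPred_eq, mul_neg, abs_neg]; exact not_le.mpr hξ), mul_zero]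
  · ext t
    rw [filtered_eq_fourierInv hφ2 hf.2.choose hX hX2 hfX t,
      Real.fourierInv_eq_fourier_comp_neg]

theorem filtered_add_of_paleyWiener {W : ℝ} {φ f z : ℝ → ℝ} (hφ : PaleyWiener W φ)
    (hf : PaleyWiener W f) (hz : Filterable φ z) :
    filtered φ (f + z) = filtered φ f + filtered φ z :=
  filtered_add (filterable_of_memLp hφ.memLp hf.memLp) hz

/-! ### Estimates for samples and perturbations -/

/-- The differences of the samples of the filtered signal decay geometrically. -/
theorem abs_fwdDiff_iter_sample_le {W T β : ℝ} (hW : 0 < W) (hT : 0 < T) {φ f : ℝ → ℝ}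
    (hφ : PaleyWiener W φ) (hf : PaleyWiener W f) (hβ : ∀ t, |filtered φ f t| ≤ β) (N : ℕ)
    (k : ℤ) : |(fwdDiff 1)^[N] (sample T (filtered φ f)) k| ≤ (T * W) ^ N * β := by
  have h1 := (isBandlimited_filtered hφ hf).norm_fwdDiff_iter_le hW hT.le
    (fun t => by rw [Complex.norm_real]; exact hβ t) N (k * T)
  have h2 : (fwdDiff T)^[N] (fun t => (filtered φ f t : ℂ)) (k * T) =
      (((fwdDiff 1)^[N] (sample T (filtered φ f)) k : ℝ) : ℂ) := by
    rw [fwdDiff_iter_eq_sum_shift, fwdDiff_iter_eq_sum_shift, Complex.ofReal_sum]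
    refine Finset.sum_congr rfl fun i _ => ?_
    simp only [sample, zsmul_eq_mul, nsmul_eq_mul, Complex.ofReal_mul, Complex.ofReal_intCast]
    congr 3
    push_cast
    ring
  rwa [h2, Complex.norm_real] at h1

/-- Perturbed modulo samples are congruent to the perturbed samples. -/
theorem exists_sub_fold_add (lam x z : ℝ) (v : ℝ) :
    ∃ c : ℤ, x + (foldedNoise lam x z + (v - fold lam (x + z))) - v = 2 * lam * c := by
  -- The folded values of `x + z` cancel and leave `x - fold lam x`.
  refine ⟨⌊x / (2 * lam) + 1 / 2⌋, ?_⟩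
  rw [fold_add, fold]
  ring

theorem perturbation_lt {lam β ζ E : ℝ} {h : ℕ} (hlam : 0 < lam) (hζ : 1 < ζ) (hE : 0 ≤ E)
    (hA : Admissible lam β ζ h E) : E < lam := by
  have h1 := hA.1
  nlinarith

theorem abs_fwdDiff_iter_add_lt {β E lam c : ℝ} {N : ℕ} {f g : ℤ → ℝ} {k : ℤ}
    (hf : |(fwdDiff 1)^[N] f k| ≤ c * β) (hg : ∀ k, |g k| ≤ E)
    (hlt : c * β + 2 ^ N * E < lam) : |(fwdDiff 1)^[N] (f + g) k| < lam := by
  rw [fwdDiff_iter_add, Pi.add_apply]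
  calc _ ≤ _ := abs_add_le _ _
    _ ≤ c * β + 2 ^ N * E := add_le_add hf (abs_fwdDiff_iter_le 1 E N g hg k)
    _ < lam := hlt

end UNO

/-! ### The reconstruction maps -/

theorem theorem5 (lam β : ℝ) (hlam : 0 < lam) (hβ : 0 < β) (hβlam : ∃ b : ℤ, β = 2 * lam * b)
    (h : ℕ) :
    -- all samples, indexed by the integers, from any estimate `V` of the modulo samples
    (∃ D : (ℤ → ℝ) → ℤ → ℝ,
      ∀ (W T ζ : ℝ), 0 < W → 0 < T → 1 < ζ → T ≤ 1 / (2 ^ h * W * Real.exp 1) →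
      ∀ (x φ z : ℝ → ℝ), UNO.PaleyWiener W x → UNO.PaleyWiener W φ → UNO.Filterable φ z →
      (∀ t, |UNO.filtered φ x t| ≤ β) →
      ∀ (V : ℤ → ℝ) (E : ℝ),
        let xs : ℤ → ℝ := UNO.sample T (UNO.filtered φ x)
        let zs : ℤ → ℝ := UNO.sample T (UNO.filtered φ z)
        let ys : ℤ → ℝ := UNO.sample T (UNO.filtered φ (x + z))
        let ytil : ℤ → ℝ := fun k => UNO.fold lam (ys k)
        let e : ℤ → ℝ := fun k => V k - ytil k
        let ztil : ℤ → ℝ := fun k => UNO.foldedNoise lam (xs k) (zs k)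
        IsLUB (Set.range fun k => |ztil k + e k|) E →
        UNO.Admissible lam β ζ h E →
        ∃ a : ℤ,
          (∀ k, D V k = xs k + ztil k + e k + 2 * lam * a) ∧
          (φ = UNO.idealLowPass W →
            ∀ k, D V k = UNO.sample T x k + ztil k + e k + 2 * lam * a)) ∧
    -- sufficiently long windows of samples, from one-bit samples through the Kaczmarz iteration
    (∃ (n₀ : ℕ) (D : (n : ℕ) → (Fin n → ℝ) → Fin n → ℝ),
      ∀ (W T ζ : ℝ), 0 < W → 0 < T → 1 < ζ → T ≤ 1 / (2 ^ h * W * Real.exp 1) →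
      ∀ (S : Type*) [MeasurableSpace S] (P : MeasureTheory.Measure S)
        [MeasureTheory.IsProbabilityMeasure P]
        (x φ : ℝ → ℝ) (z : S → ℝ → ℝ),
      UNO.PaleyWiener W x → UNO.PaleyWiener W φ → (∀ s, UNO.Filterable φ (z s)) →
      (∀ t, |UNO.filtered φ x t| ≤ β) →
      ∀ (m n : ℕ), n₀ ≤ n →
      ∀ (k₀ : ℤ) (τ : Fin m → S → Fin n → ℝ),
      (∀ l, ProbabilityTheory.HasLaw (τ l)
        (MeasureTheory.Measure.pi fun _ : Fin n =>
          ProbabilityTheory.gaussianReal 0 (Real.toNNReal (lam ^ 2 / 9))) P) →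
      ∀ (j : ℕ → S → Fin m × Fin n),
      (∀ i, ProbabilityTheory.HasLaw (j i) (ProbabilityTheory.uniformOn Set.univ) P) →
      ProbabilityTheory.iIndepFun j P →
      ∀ (v₀ : Fin n → ℝ) (imax : ℕ) (s : S),
        let xs : Fin n → ℝ := fun k => UNO.sample T (UNO.filtered φ x) (k₀ + (k : ℕ))
        let zs : Fin n → ℝ := fun k => UNO.sample T (UNO.filtered φ (z s)) (k₀ + (k : ℕ))
        let ys : Fin n → ℝ := fun k => UNO.sample T (UNO.filtered φ (x + z s)) (k₀ + (k : ℕ))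
        let ytil : Fin n → ℝ := fun k => UNO.fold lam (ys k)
        let τs : Fin m → Fin n → ℝ := fun l => τ l s
        let r : Fin m → Fin n → ℝ := UNO.oneBit ytil τs
        let V : Fin n → ℝ := UNO.rka r τs v₀ (fun i => j i s) imax
        let e : Fin n → ℝ := fun k => V k - ytil k
        let ztil : Fin n → ℝ := fun k => UNO.foldedNoise lam (xs k) (zs k)
        UNO.Admissible lam β ζ h ‖ztil + e‖ →
        ∃ a : ℤ,
          (∀ k, D n V k = xs k + ztil k + e k + 2 * lam * a) ∧
          (φ = UNO.idealLowPass W →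
            ∀ k, D n V k = UNO.sample T x (k₀ + (k : ℕ)) + ztil k + e k + 2 * lam * a)) := by

  obtain ⟨N, hN⟩ := UNO.exists_order lam β hlam hβ hβlam h
  refine ⟨?_, ?_⟩
  · obtain ⟨D, hD⟩ := UNO.exists_choice (UNO.IsUnfolding lam (β + lam) N)
    refine ⟨D, fun W T ζ hW hT hζ hTle x φ z hx hφ hz hβx V E => ?_⟩
    intro xs zs ys ytil e ztil hE hA
    have hys : ∀ k, ys k = xs k + zs k := fun k =>
      congrFun (UNO.filtered_add_of_paleyWiener hφ hx hz) _
    have hεE : ∀ k, |ztil k + e k| ≤ E := fun k => hE.1 (mem_range_self k)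
    have hE0 : 0 ≤ E := (abs_nonneg _).trans (hεE 0)
    have hElam := UNO.perturbation_lt hlam hζ hE0 hA
    have hu : UNO.IsUnfolding lam (β + lam) N V (xs + fun k => ztil k + e k) := by
      refine ⟨fun k => ?_, fun k => ?_, fun k => ?_⟩
      · have := UNO.exists_sub_fold_add lam (xs k) (zs k) (V k)
        rwa [← hys k] at this
      · have := hβx (k * T)
        have := hεE k
        exact (abs_add_le _ _).trans (by linarith [show |xs k| ≤ β from hβx _])
      · exact UNO.abs_fwdDiff_iter_add_lt
          (UNO.abs_fwdDiff_iter_sample_le hW hT hφ hx hβx N k) hεE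
          (hN W T ζ E hW hT hζ hTle hE0 hA)
    obtain ⟨a, ha⟩ := hu.unique hlam (hD V _ hu)
    have ha' : ∀ k, D V k = xs k + ztil k + e k + 2 * lam * a := fun k => by
      rw [ha k, Pi.add_apply]
      ring
    refine ⟨a, ha', fun hφi k => ?_⟩
    subst hφi
    rw [ha' k, ← UNO.filtered_idealLowPass hW hx hφ]
  · obtain ⟨n₀, hn₀⟩ := UNO.IsWindowUnfolding.exists_unique lam (β + lam) hlam N
    choose D hD using fun n => UNO.exists_choice (UNO.IsWindowUnfolding lam (β + lam) N n)
    refine ⟨n₀, D, fun W T ζ hW hT hζ hTle S _ P _ x φ z hx hφ hz hβx m n hn k₀ τ _ j _ _ v₀ imax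
      s => ?_⟩
    intro xs zs ys ytil τs r V e ztil hA
    have hys : ∀ k, ys k = xs k + zs k := fun k =>
      congrFun (UNO.filtered_add_of_paleyWiener hφ hx (hz s)) _
    have hE0 : 0 ≤ ‖ztil + e‖ := norm_nonneg _
    have hεE : ∀ k, |ztil k + e k| ≤ ‖ztil + e‖ := fun k => norm_le_pi_norm (ztil + e) k
    have hElam := UNO.perturbation_lt hlam hζ hE0 hA
    have hu : UNO.IsWindowUnfolding lam (β + lam) N n V (xs + (ztil + e)) := by
      refine ⟨fun k => ?_, fun k => ?_, ?_⟩
      · have := UNO.exists_sub_fold_add lam (xs k) (zs k) (V k)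
        rwa [← hys k] at this
      · exact (abs_add_le _ _).trans
          (add_le_add (show |xs k| ≤ β from hβx _) ((hεE k).trans hElam.le))
      -- Extends the perturbation to all integers without increasing its bound: zero to the right of
      -- the window, and, since `toNat` truncates, the first entry repeated to the left when `n >
      -- 0`.
      · set g : ℤ → ℝ := fun i =>
          if hi : (i - k₀).toNat < n then (ztil + e) ⟨(i - k₀).toNat, hi⟩ else 0 with hg
        have hgE : ∀ i, |g i| ≤ ‖ztil + e‖ := fun i => by
          simp only [hg]
          split_ifs with hi
          · exact hεE _
          · simp
        refine ⟨fun i => (UNO.sample T (UNO.filtered φ x) + g) (k₀ + i), fun k => ?_,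
          fun k _ => ?_⟩
        · simp [hg, xs]
        · rw [UNO.fwdDiff_iter_congr (1 : ℕ) (1 : ℤ) _
            (UNO.sample T (UNO.filtered φ x) + g) N k (k₀ + k) fun i _ => by simp [add_assoc]]
          exact UNO.abs_fwdDiff_iter_add_lt
            (UNO.abs_fwdDiff_iter_sample_le hW hT hφ hx hβx N _) hgE
            (hN W T ζ _ hW hT hζ hTle hE0 hA)
    obtain ⟨a, ha⟩ := hn₀ n hn V _ _ hu (hD n V _ hu)
    have ha' : ∀ k, D n V k = xs k + ztil k + e k + 2 * lam * a := fun k => by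
      rw [ha k, Pi.add_apply, Pi.add_apply]
      ring
    refine ⟨a, ha', fun hφi k => ?_⟩
    subst hφi
    rw [ha' k, ← UNO.filtered_idealLowPass hW hx hφ]
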